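/- There are a constant $c$ and a polynomial $p$ such that the following holds for every $n\ge 1$, every field $\mathbb F_{2^n}$ with $2^n$ elements, represented with respect to an arbitrary $\mathbb F_2$-basis (for instance a polynomial basis of $\mathbb F_2[x]/(f)$ with $f$ irreducible of degree $n$), where the $n$ coordinates of a field element are stored in $n$ qubits, and all $d_1,d_2\in\mathbb F_{2^n}$ with $d_1\neq 0$ and $\mathrm{Tr}(d_2)=1$ (absolute trace). Let $E$ be the complete binary Edwards curve, i.e. the set of $(x,y)\in\mathbb F_{2^n}^2$ with $$d_1(x+y)+d_2(x^2+y^2)=xy+xy(x+y)+x^2y^2 ,$$ with the addition law $(x_1,y_1)+(x_2,y_2)=(x_3,y_3)$, $$x_3=\frac{d_1(x_1+x_2)+d_2(x_1+y_1)(x_2+y_2)+(x_1+x_1^2)(x_2(y_1+y_2+1)+y_1y_2)}{d_1+(x_1+x_1^2)(x_2+y_2)},$$ $$y_3=\frac{d_1(y_1+y_2)+d_2(x_1+y_1)(x_2+y_2)+(y_1+y_1^2)(y_2(x_1+x_2+1)+x_1x_2)}{d_1+(y_1+y_1^2)(x_2+y_2)}.$$ A triple $(X,Y,Z)\in\mathbb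 F_{2^n}^3$ with $Z\ne 0$ is a projective representation of the point $(X/Z,Y/Z)$. Then there is a quantum circuit, consisting of Clifford gates (Hadamard, $S$, CNOT), gates $T,T^\dagger$ and Toffoli gates, of depth at most $c\,n$, with at most $p(n)$ gates and on at most $p(n)$ qubits (ancillae included), such that for all (not necessarily distinct) points $P_1,P_2\in E$ and all projective representations $(X_i,Y_i,Z_i)$ of $P_i$ ($i=1,2$), the denominators above are non-zero and the circuit maps $$|X_1\rangle|Y_1\rangle|Z_1\rangle|X_2\rangle|Y_2\rangle|Z_2\rangle|0\rangle|0\rangle|0\rangle|0\cdots0\rangle\longmapsto|X_1\rangle|Y_1\rangle|Z_1\rangle|X_2\rangle|Y_2\rangle|Z_2\rangle|X_3\rangle|Y_3\rangle|Z_3\rangle|0\cdots0\rangle ,$$ where $(X_3,Y_3,Z_3)$ is some projective representation of $P_1+P_2$ and the last register consists of the ancilla qubits, which are returned to $0$. -/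

import Mathlib

/-! ### Quantum circuits

The qubits of a circuit are indexed by a finite type `Q`.  A computational basis state is labelled by
a bit string `Q → ZMod 2`, and operators are given by their matrices in the computational basis. -/

/-- Elementary gates on the qubits `Q`: the Clifford generators `H`, `S` and CNOT, the gates `T` and
`T†`, and the Toffoli gate.  For the multi-qubit gates the qubits acted on are distinct, and the last
one is the target. -/
inductive QGate (Q : Type) : Type
  | hadamard (q : Q) : QGate Q
  | phaseS (q : Q) : QGate Q
  | phaseT (q : Q) : QGate Q
  | phaseTdg (q : Q) : QGate Q
  | cnot (c t : Q) (hct : c ≠ t) : QGate Q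
  | toffoli (c₁ c₂ t : Q) (hcc : c₁ ≠ c₂) (h₁ : c₁ ≠ t) (h₂ : c₂ ≠ t) : QGate Q

namespace QGate

variable {Q : Type} [DecidableEq Q]

/-- The set of qubits a gate acts on. -/
def support : QGate Q → Finset Q
  | hadamard q => {q}
  | phaseS q => {q}
  | phaseT q => {q}
  | phaseTdg q => {q}
  | cnot c t _ => {c, t}
  | toffoli c₁ c₂ t _ _ _ => {c₁, c₂, t}

/-- The diagonal gate multiplying `|x⟩` by `ω` if `x q = 1`, and fixing it otherwise. -/
def phaseMatrix [Fintype Q] (q : Q) (ω : ℂ) : Matrix (Q → ZMod 2) (Q → ZMod 2) ℂ :=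
  Matrix.diagonal fun x => if x q = 1 then ω else 1

/-- The matrix of a gate in the computational basis; the entry at `(y, x)` is the amplitude
`⟨y| g |x⟩`. -/
noncomputable def toMatrix [Fintype Q] : QGate Q → Matrix (Q → ZMod 2) (Q → ZMod 2) ℂ
  | hadamard q => Matrix.of fun y x =>
      if ∀ r, r ≠ q → y r = x r then
        (if y q = 1 ∧ x q = 1 then -1 else 1) / (Real.sqrt 2 : ℂ)
      else 0
  | phaseS q => phaseMatrix q Complex.I
  | phaseT q => phaseMatrix q (Complex.exp (Real.pi * Complex.I / 4))
  | phaseTdg q => phaseMatrix q (Complex.exp (-(Real.pi * Complex.I / 4)))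
  | cnot c t _ => Matrix.of fun y x =>
      if y = Function.update x t (x t + x c) then 1 else 0
  | toffoli c₁ c₂ t _ _ _ => Matrix.of fun y x =>
      if y = Function.update x t (x t + x c₁ * x c₂) then 1 else 0

end QGate

/-- A quantum circuit on the qubits `Q`: a sequence of layers (time steps), each consisting of gates
that act on pairwise disjoint sets of qubits.  The first layer is applied first. -/
structure QCircuit (Q : Type) [DecidableEq Q] : Type where
  layers : List (List (QGate Q))
  disjoint : ∀ L ∈ layers, L.Pairwise fun g h => Disjoint g.support h.support

namespace QCircuit

variable {Q : Type} [DecidableEq Q]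

/-- The depth: the number of layers. -/
def depth (C : QCircuit Q) : ℕ := C.layers.length

/-- The size: the total number of gates. -/
def size (C : QCircuit Q) : ℕ := C.layers.flatten.length

/-- The operator implemented by the circuit, as a matrix in the computational basis. -/
noncomputable def toMatrix [Fintype Q] (C : QCircuit Q) :
    Matrix (Q → ZMod 2) (Q → ZMod 2) ℂ :=
  C.layers.flatten.foldl (fun U g => g.toMatrix * U) 1

end QCircuit

/-- The computational basis state `|x⟩`. -/
def ket {Q : Type} [DecidableEq Q] [Fintype Q] (x : Q → ZMod 2) : (Q → ZMod 2) → ℂ :=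
  Pi.single x 1

/-! ### Complete binary Edwards curves -/

section Edwards

variable {F : Type*} [Field F]

/-- The rational points of the affine curve
`d₁ (x + y) + d₂ (x² + y²) = x y + x y (x + y) + x² y²`. -/
def binaryEdwards (d₁ d₂ : F) : Set (F × F) :=
  {P | d₁ * (P.1 + P.2) + d₂ * (P.1 ^ 2 + P.2 ^ 2) =
    P.1 * P.2 + P.1 * P.2 * (P.1 + P.2) + P.1 ^ 2 * P.2 ^ 2}

/-- The addition law on a complete binary Edwards curve: `P₃ = P₁ + P₂`, the denominators of the two
fractions that define the coordinates of the sum being non-zero. -/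
def IsEdwardsSum (d₁ d₂ : F) (P₁ P₂ P₃ : F × F) : Prop :=
  let x₁ := P₁.1
  let y₁ := P₁.2
  let x₂ := P₂.1
  let y₂ := P₂.2
  d₁ + (x₁ + x₁ ^ 2) * (x₂ + y₂) ≠ 0 ∧
  d₁ + (y₁ + y₁ ^ 2) * (x₂ + y₂) ≠ 0 ∧
  P₃.1 = (d₁ * (x₁ + x₂) + d₂ * (x₁ + y₁) * (x₂ + y₂)
      + (x₁ + x₁ ^ 2) * (x₂ * (y₁ + y₂ + 1) + y₁ * y₂))
    / (d₁ + (x₁ + x₁ ^ 2) * (x₂ + y₂)) ∧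
  P₃.2 = (d₁ * (y₁ + y₂) + d₂ * (x₁ + y₁) * (x₂ + y₂)
      + (y₁ + y₁ ^ 2) * (y₂ * (x₁ + x₂ + 1) + x₁ * x₂))
    / (d₁ + (y₁ + y₁ ^ 2) * (x₂ + y₂))

/-- `(X, Y, Z)` is a projective representation of the affine point `P`. -/
def IsProjRep (X Y Z : F) (P : F × F) : Prop :=
  Z ≠ 0 ∧ X / Z = P.1 ∧ Y / Z = P.2

end Edwards

/-! ### Registers holding field elements -/

/-- `k` registers of `n` qubits each, together with `a` ancilla qubits. -/
abbrev RegQubits (k n a : ℕ) : Type := (Fin k × Fin n) ⊕ Fin a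

/-- The bit string in which register `i` holds the coordinates of the field element `v i` with respect
to the basis `b`, one coordinate per qubit, and in which all ancilla qubits are `0`. -/
noncomputable def regBits {F : Type*} [Field F] [Algebra (ZMod 2) F] {k n : ℕ} (a : ℕ)
    (b : Module.Basis (Fin n) (ZMod 2) F) (v : Fin k → F) : RegQubits k n a → ZMod 2 :=
  Sum.elim (fun p => b.repr (v p.1) p.2) (fun _ => 0)

/-! ### Reversible classical circuits -/

/-! The addition law is evaluated by a straight-line program of fixed length on registers holding
field elements; it suffices that each instruction has depth linear in n. CNOT and Toffoli gates
alone suffice, so everything reduces to maps on bit strings.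

For a bilinear map, the obstacle is that n³ structure constants added directly into n target qubits
would need about n² layers. Instead the products of coordinates are written to an n × n array,
contracted into a second n × n array (n² targets per layer, hence n layers), and the rows of the
latter are summed into the target register. Repeating the first two stages clears both arrays, for a
total depth of 5n (`realizes_bilinear`). Nothing depends on the choice of basis.

Clearing denominators turns the addition law into polynomials in the projective coordinates. The
program computes them in scratch registers, adds the result to the output registers and runs
backwards (`RegOp.runList_compute_uncompute`). The resulting Z₃ is non-zero because a vanishing
denominator would write d₂ as u + u², which has trace 0 (`binaryEdwards_denominator_ne_zero`). -/

namespace QGate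

variable {Q : Type} [DecidableEq Q]

/-- The permutation of the bit strings induced by a CNOT or a Toffoli gate (the identity for the
other gates). -/
def act : QGate Q → (Q → ZMod 2) → Q → ZMod 2
  | cnot c t _, x => Function.update x t (x t + x c)
  | toffoli c₁ c₂ t _ _ _, x => Function.update x t (x t + x c₁ * x c₂)
  | _, x => x

/-- The gates that permute the computational basis states: CNOT and Toffoli. -/
def IsReversible : QGate Q → Prop
  | cnot _ _ _ => True
  | toffoli _ _ _ _ _ _ => True
  | _ => False

theorem toMatrix_mulVec_ket [Fintype Q] {g : QGate Q} (hg : g.IsReversible) (x : Q → ZMod 2) :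
    g.toMatrix.mulVec (ket x) = ket (g.act x) := by
  cases g <;> simp only [IsReversible] at hg <;>
  · ext y
    simp [toMatrix, ket, act, Pi.single_apply]

/-- Relabelling the qubits of a gate. -/
def map {R : Type} (e : Q ≃ R) : QGate Q → QGate R
  | hadamard q => hadamard (e q)
  | phaseS q => phaseS (e q)
  | phaseT q => phaseT (e q)
  | phaseTdg q => phaseTdg (e q)
  | cnot c t h => cnot (e c) (e t) (e.injective.ne h)
  | toffoli c₁ c₂ t h h₁ h₂ =>
      toffoli (e c₁) (e c₂) (e t) (e.injective.ne h) (e.injective.ne h₁) (e.injective.ne h₂)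

variable {R : Type} [DecidableEq R]

theorem support_map (e : Q ≃ R) (g : QGate Q) : (g.map e).support = g.support.map e.toEmbedding := by
  cases g <;> simp [map, support]

theorem act_map (e : Q ≃ R) (g : QGate Q) (x : R → ZMod 2) :
    (g.map e).act x ∘ e = g.act (x ∘ e) := by
  cases g <;> simp [map, act, Function.update_comp_equiv]

end QGate

theorem QGate.IsReversible.map {Q R : Type} {g : QGate Q} (hg : g.IsReversible) (e : Q ≃ R) :
    (g.map e).IsReversible := by
  cases g <;> simp_all [QGate.map, IsReversible]

namespace QCircuit

variable {Q : Type} [DecidableEq Q]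

/-- The action of a reversible circuit on the bit strings. -/
def run (C : QCircuit Q) (x : Q → ZMod 2) : Q → ZMod 2 :=
  C.layers.flatten.foldl (fun x g => g.act x) x

/-- All gates of the circuit are CNOT or Toffoli gates. -/
def IsReversible (C : QCircuit Q) : Prop := ∀ g ∈ C.layers.flatten, g.IsReversible

theorem foldl_mulVec_ket [Fintype Q] (l : List (QGate Q)) (hl : ∀ g ∈ l, g.IsReversible)
    (U : Matrix (Q → ZMod 2) (Q → ZMod 2) ℂ) (x y : Q → ZMod 2) (h : U.mulVec (ket x) = ket y) :
    (l.foldl (fun U g => g.toMatrix * U) U).mulVec (ket x) =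
      ket (l.foldl (fun x g => g.act x) y) := by
  induction l generalizing U y with
  | nil => simpa using h
  | cons g l ih =>
    refine ih (fun g' hg' => hl g' (List.mem_cons_of_mem _ hg')) _ _ ?_
    rw [← Matrix.mulVec_mulVec, h, QGate.toMatrix_mulVec_ket (hl g List.mem_cons_self)]

/-- Reduces the complex operator to the classical action `run`, the only semantics needed for the
construction. -/
theorem IsReversible.toMatrix_mulVec_ket [Fintype Q] {C : QCircuit Q} (hC : C.IsReversible)
    (x : Q → ZMod 2) : C.toMatrix.mulVec (ket x) = ket (C.run x) :=
  foldl_mulVec_ket _ hC _ _ _ (Matrix.one_mulVec _)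

/-- Running one circuit after another. -/
def append (C D : QCircuit Q) : QCircuit Q where
  layers := C.layers ++ D.layers
  disjoint L hL := (List.mem_append.1 hL).elim (C.disjoint L) (D.disjoint L)

/-- Relabelling the qubits of a circuit. -/
def map {R : Type} [DecidableEq R] (e : Q ≃ R) (C : QCircuit Q) : QCircuit R where
  layers := C.layers.map (List.map (QGate.map e))
  disjoint L hL := by
    obtain ⟨L', hL', rfl⟩ := List.mem_map.1 hL
    refine List.pairwise_map.2 ((C.disjoint L' hL').imp fun h => ?_)
    rw [QGate.support_map, QGate.support_map]
    exact (Finset.disjoint_map _).2 h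

variable {R : Type} [DecidableEq R]

theorem depth_map (e : Q ≃ R) (C : QCircuit Q) : (C.map e).depth = C.depth := by
  simp [depth, map]

theorem size_map (e : Q ≃ R) (C : QCircuit Q) : (C.map e).size = C.size := by
  simp [size, map, ← List.map_flatten]

theorem IsReversible.map {C : QCircuit Q} (hC : C.IsReversible) (e : Q ≃ R) :
    (C.map e).IsReversible := by
  intro g hg
  rw [QCircuit.map, ← List.map_flatten] at hg
  obtain ⟨g', hg', rfl⟩ := List.mem_map.1 hg
  exact (hC g' hg').map e

theorem run_map (e : Q ≃ R) (C : QCircuit Q) (x : R → ZMod 2) :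
    (C.map e).run x ∘ e = C.run (x ∘ e) := by
  simp only [run, map, ← List.map_flatten]
  generalize C.layers.flatten = l
  induction l generalizing x with
  | nil => rfl
  | cons g l ih => simp only [List.map_cons, List.foldl_cons, ih, QGate.act_map]

end QCircuit

/-- There is a reversible circuit of depth at most `D` with at most `N` gates which maps the encoding
of every state `s` to the encoding of `f s`. -/
def Realizes {Q : Type} [DecidableEq Q] {S : Type*} (enc : S → Q → ZMod 2) (D N : ℕ) (f : S → S) :
    Prop :=
  ∃ C : QCircuit Q, C.depth ≤ D ∧ C.size ≤ N ∧ C.IsReversible ∧ ∀ s, C.run (enc s) = enc (f s)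

namespace Realizes

variable {Q : Type} [DecidableEq Q] {S : Type*} {enc : S → Q → ZMod 2} {D D' N N' : ℕ} {f g : S → S}

theorem refl (enc : S → Q → ZMod 2) : Realizes enc 0 0 id :=
  ⟨⟨[], by simp⟩, by simp [QCircuit.depth], by simp [QCircuit.size],
    by simp [QCircuit.IsReversible], by simp [QCircuit.run]⟩

theorem comp (hg : Realizes enc D' N' g) (hf : Realizes enc D N f) :
    Realizes enc (D + D') (N + N') (g ∘ f) := by
  obtain ⟨A, hA, hA', hAr, hAf⟩ := hf
  obtain ⟨B, hB, hB', hBr, hBg⟩ := hg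
  refine ⟨A.append B, ?_, ?_, ?_, fun s => ?_⟩
  · simp only [QCircuit.depth, QCircuit.append, List.length_append] at *
    omega
  · simp only [QCircuit.size, QCircuit.append, List.flatten_append, List.length_append] at *
    omega
  · intro q hq
    simp only [QCircuit.append, List.flatten_append, List.mem_append] at hq
    exact hq.elim (hAr q) (hBr q)
  · have : (A.append B).run (enc s) = B.run (A.run (enc s)) := by
      simp [QCircuit.run, QCircuit.append]
    rw [this, hAf, hBg, Function.comp_apply]

theorem mono (hf : Realizes enc D N f) (hD : D ≤ D') (hN : N ≤ N') : Realizes enc D' N' f := by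
  obtain ⟨A, hA, hA', h⟩ := hf
  exact ⟨A, hA.trans hD, hA'.trans hN, h⟩

end Realizes

/-- By `hf` no gate changes what another gate adds, so all increments can be evaluated on the
initial bit string. -/
theorem foldl_act_eq_sum {Q κ : Type} [DecidableEq Q] (g : κ → QGate Q) (t : κ → Q)
    (f : κ → (Q → ZMod 2) → ZMod 2)
    (hact : ∀ i x, (g i).act x = Function.update x (t i) (x (t i) + f i x))
    (hf : ∀ i j x a, f i (Function.update x (t j) a) = f i x) (l : List κ) (x : Q → ZMod 2) (q : Q) :
    (l.map g).foldl (fun x g => g.act x) x q =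
      x q + (l.map fun i => if t i = q then f i x else 0).sum := by
  induction l generalizing x with
  | nil => simp
  | cons i l ih =>
    simp only [List.map_cons, List.foldl_cons, ih, List.sum_cons, hact, hf]
    by_cases h : t i = q
    · subst h
      simp [add_assoc]
    · simp [h, Function.update_of_ne (Ne.symm h)]

/-- Gates which add to their targets functions of qubits that are not targets can be scheduled in
arbitrary order. -/
theorem Realizes.of_layers {Q ι : Type} [DecidableEq Q] [Fintype ι] {S : Type*}
    {enc : S → Q → ZMod 2} {n : ℕ} (J : Fin n → Finset ι) (g : Fin n → ι → QGate Q)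
    (t : Fin n → ι → Q) (f : Fin n → ι → (Q → ZMod 2) → ZMod 2) (F : S → S)
    (hrev : ∀ s i, (g s i).IsReversible)
    (hact : ∀ s i x, (g s i).act x = Function.update x (t s i) (x (t s i) + f s i x))
    (hf : ∀ s i s' j x a, f s i (Function.update x (t s' j) a) = f s i x)
    (hdisj : ∀ s i j, i ≠ j → Disjoint (g s i).support (g s j).support)
    (hF : ∀ σ q, enc (F σ) q =
      enc σ q + ∑ s, ∑ i ∈ J s, if t s i = q then f s i (enc σ) else 0) :
    Realizes enc n (n * Fintype.card ι) F := by
  have key : ((List.finRange n).map fun s => (J s).toList.map (g s)).flatten =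
      (((List.finRange n).map fun s => (J s).toList.map (Prod.mk s)).flatten).map
        fun p => g p.1 p.2 := by
    simp [List.map_flatten, Function.comp_def]
  refine ⟨⟨(List.finRange n).map fun s => (J s).toList.map (g s), ?_⟩, ?_, ?_, ?_, fun σ => ?_⟩
  · intro L hL
    obtain ⟨s, -, rfl⟩ := List.mem_map.1 hL
    exact List.pairwise_map.2 ((J s).nodup_toList.imp fun h => hdisj s _ _ h)
  · simp [QCircuit.depth]
  · simp only [QCircuit.size, List.length_flatten, List.map_map]
    refine (List.sum_le_card_nsmul _ (Fintype.card ι) ?_).trans (by simp)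
    intro m hm
    obtain ⟨s, -, rfl⟩ := List.mem_map.1 hm
    simpa using Finset.card_le_univ (J s)
  · intro q hq
    rw [key] at hq
    obtain ⟨p, -, rfl⟩ := List.mem_map.1 hq
    exact hrev _ _
  · ext q
    rw [QCircuit.run, key, foldl_act_eq_sum (fun p : Fin n × ι => g p.1 p.2) (fun p => t p.1 p.2)
      (fun p => f p.1 p.2) (fun p => hact _ _) (fun p p' => hf _ _ _ _), hF]
    congr 1
    rw [List.map_flatten, List.sum_flatten, List.map_map, List.map_map, ← List.ofFn_eq_map,
      List.sum_ofFn]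
    refine Finset.sum_congr rfl fun s _ => ?_
    simp [Function.comp_def, Finset.sum_map_toList]

/-! ### Circuits for linear and bilinear maps -/

theorem Realizes.of_cnot_layers {Q ι : Type} [DecidableEq Q] [Fintype ι] {S : Type*}
    {enc : S → Q → ZMod 2} {n : ℕ} (J : Fin n → Finset ι) (c t : Fin n → ι → Q)
    (hct : ∀ s i s' j, c s i ≠ t s' j) (hc : ∀ s, (c s).Injective) (ht : ∀ s, (t s).Injective)
    (F : S → S)
    (hF : ∀ σ q, enc (F σ) q =
      enc σ q + ∑ s, ∑ i ∈ J s, if t s i = q then enc σ (c s i) else 0) :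
    Realizes enc n (n * Fintype.card ι) F := by
  refine Realizes.of_layers J (fun s i => .cnot (c s i) (t s i) (hct s i s i)) t
    (fun s i x => x (c s i)) F (fun _ _ => trivial) (fun _ _ _ => rfl) ?_ ?_ hF
  · intro s i s' j x a
    exact Function.update_of_ne (hct _ _ _ _) _ _
  · intro s i j hij
    simp [QGate.support, (hc s).ne hij.symm, (ht s).ne hij.symm, hct, (hct _ _ _ _).symm]

/-- Placing a CNOT exactly where a coefficient is 1 realizes the weighted sum. -/
theorem ZMod.sum_filter_eq_one {ι : Type*} [Fintype ι] (m f : ι → ZMod 2) :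
    ∑ i with m i = 1, f i = ∑ i, m i * f i := by
  rw [Finset.sum_filter]
  refine Finset.sum_congr rfl fun i _ => ?_
  generalize m i = a, f i = c
  revert a c
  decide

/-- The cyclic diagonals partition the n × n index square. Layer s takes the pairs (i, i + s), in
which no row or column index repeats, so its gates are disjoint. -/
theorem Fin.sum_sum_add {n : ℕ} [NeZero n] {M : Type*} [AddCommMonoid M] (h : Fin n → Fin n → M) :
    ∑ s, ∑ i, h i (i + s) = ∑ i, ∑ j, h i j := by
  rw [Finset.sum_comm]
  exact Finset.sum_congr rfl fun i _ => Equiv.sum_comp (Equiv.addLeft i) (h i)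

section Registers

variable {F : Type*} [Field F] [Algebra (ZMod 2) F] {ρ : Type} {n : ℕ}

/-- `n`-qubit registers indexed by `ρ`, and two `n × n` arrays of work qubits. -/
abbrev WorkQubits (ρ : Type) (n : ℕ) : Type :=
  (ρ × Fin n) ⊕ ((Fin n × Fin n) ⊕ (Fin n × Fin n))

/-- The contents of the registers and of the two work arrays. -/
abbrev WorkState (F : Type*) (ρ : Type) (n : ℕ) : Type _ :=
  (ρ → F) × (Fin n → Fin n → ZMod 2) × (Fin n → Fin n → ZMod 2)

/-- The bit string describing a state. -/
noncomputable def workBits (b : Module.Basis (Fin n) (ZMod 2) F) (σ : WorkState F ρ n) :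
    WorkQubits ρ n → ZMod 2 :=
  Sum.elim (fun p => b.repr (σ.1 p.1) p.2)
    (Sum.elim (fun p => σ.2.1 p.1 p.2) (fun p => σ.2.2 p.1 p.2))

variable [DecidableEq ρ] (b : Module.Basis (Fin n) (ZMod 2) F)

theorem repr_linear_apply (L : F →ₗ[ZMod 2] F) (x : F) (k : Fin n) :
    b.repr (L x) k = ∑ i, b.repr (L (b i)) k * b.repr x i := by
  conv_lhs => rw [← b.sum_repr x]
  simp only [map_sum, map_smul, Finsupp.coe_finsetSum, Finset.sum_apply, Finsupp.smul_apply,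
    smul_eq_mul, mul_comm]

theorem repr_bilinear_apply (β : F →ₗ[ZMod 2] F →ₗ[ZMod 2] F) (x y : F) (k : Fin n) :
    b.repr (β x y) k = ∑ i, ∑ j, b.repr (β (b i) (b j)) k * (b.repr x i * b.repr y j) := by
  conv_lhs => rw [← b.sum_repr x, ← b.sum_repr y]
  simp only [map_sum, map_smul, LinearMap.sum_apply, LinearMap.smul_apply, Finsupp.coe_finsetSum,
    Finset.sum_apply, Finsupp.smul_apply, smul_eq_mul, Finset.mul_sum]
  rw [Finset.sum_comm]
  exact Finset.sum_congr rfl fun i _ => Finset.sum_congr rfl fun j _ => by ring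

theorem repr_update_add (v : ρ → F) (c : ρ) (z : F) (r : ρ) (k : Fin n) :
    b.repr (Function.update v c (v c + z) r) k =
      b.repr (v r) k + if c = r then b.repr z k else 0 := by
  by_cases h : c = r
  · subst h
    simp
  · simp [h, Function.update_of_ne (Ne.symm h)]

/-- Adding the row sums of the second work array to a register. -/
theorem realizes_rowSum (c : ρ) :
    Realizes (workBits b) n (n * n) fun σ : WorkState F ρ n =>
      (Function.update σ.1 c (σ.1 c + ∑ k, (∑ i, σ.2.2 k i) • b k), σ.2) := by
  -- Layer s adds column s of the array to the register, one qubit per row.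
  have := Realizes.of_cnot_layers (enc := workBits b) (J := fun _ => (Finset.univ : Finset (Fin n)))
    (c := fun s k => .inr (.inr (k, s))) (t := fun s k => .inl (c, k))
    (by simp) (fun s i j h => by simpa using h) (fun s i j h => by simpa using h)
    (fun σ : WorkState F ρ n =>
      (Function.update σ.1 c (σ.1 c + ∑ k, (∑ i, σ.2.2 k i) • b k), σ.2)) ?_
  · simpa using this
  · intro σ q
    rcases q with ⟨r, k⟩ | q
    · simp only [workBits, Sum.elim_inl, repr_update_add, b.repr_sum_self]
      by_cases h : c = r <;> simp [h]
    · simp [workBits]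

variable [NeZero n]

/-- Adding the image of a register under a linear map to another register. -/
theorem realizes_linear {a c : ρ} (hac : a ≠ c) (L : F →ₗ[ZMod 2] F) :
    Realizes (workBits b) n (n * n) fun σ : WorkState F ρ n =>
      (Function.update σ.1 c (σ.1 c + L (σ.1 a)), σ.2) := by
  have := Realizes.of_cnot_layers (enc := workBits b)
    (J := fun s => {i : Fin n | b.repr (L (b i)) (i + s) = 1})
    (c := fun _ i => .inl (a, i)) (t := fun s i => .inl (c, i + s))
    (by simp [hac]) (fun s i j h => by simpa using h) (fun s i j h => by simpa using h)
    (fun σ : WorkState F ρ n => (Function.update σ.1 c (σ.1 c + L (σ.1 a)), σ.2)) ?_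
  · simpa using this
  · intro σ q
    simp only [ZMod.sum_filter_eq_one]
    rw [Fin.sum_sum_add fun i j => b.repr (L (b i)) j *
      if Sum.inl (c, j) = q then workBits b σ (.inl (a, i)) else 0]
    rcases q with ⟨r, k⟩ | q
    · simp only [workBits, Sum.elim_inl, repr_update_add]
      rw [repr_linear_apply]
      by_cases h : c = r <;> simp [h]
    · simp [workBits]

/-- Adding the tensor product of two registers to the first work array. -/
theorem realizes_tensor {a a' : ρ} (ha : a ≠ a') :
    Realizes (workBits b) n (n * n) fun σ : WorkState F ρ n =>
      (σ.1, (fun i j => σ.2.1 i j + b.repr (σ.1 a) i * b.repr (σ.1 a') j), σ.2.2) := by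
  have := Realizes.of_layers (enc := workBits b) (J := fun _ => Finset.univ)
    (g := fun s i : Fin n => .toffoli (.inl (a, i)) (.inl (a', i + s)) (.inr (.inl (i, i + s)))
      (by simp [ha]) (by simp) (by simp))
    (t := fun s i => .inr (.inl (i, i + s)))
    (f := fun s i x => x (.inl (a, i)) * x (.inl (a', i + s)))
    (fun σ : WorkState F ρ n =>
      (σ.1, (fun i j => σ.2.1 i j + b.repr (σ.1 a) i * b.repr (σ.1 a') j), σ.2.2))
    (fun _ _ => trivial) (fun _ _ _ => rfl) (by simp)
    (fun s i j hij => by simp [QGate.support, hij.symm, ha, ha.symm]) ?_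
  · simpa using this
  · intro σ q
    rw [Fin.sum_sum_add fun i j => if Sum.inr (.inl (i, j)) = q then
      workBits b σ (.inl (a, i)) * workBits b σ (.inl (a', j)) else 0]
    rcases q with q | ⟨i, j⟩ | q
    · simp [workBits]
    · simp [workBits, ite_and]
    · simp [workBits]

/-- Contracting the first work array with a fixed tensor into the second one. -/
theorem realizes_contract (m : Fin n → Fin n → Fin n → ZMod 2) :
    Realizes (workBits b) n (n * (n * n)) fun σ : WorkState F ρ n =>
      (σ.1, σ.2.1, fun k i => σ.2.2 k i + ∑ j, m i j k * σ.2.1 i j) := by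
  -- For fixed s the map (i, j) ↦ (j + s, i) is injective, so a single layer can use all n² entries
  -- as controls.
  have := Realizes.of_cnot_layers (enc := workBits b)
    (J := fun s => {p : Fin n × Fin n | m p.1 p.2 (p.2 + s) = 1})
    (c := fun _ p => .inr (.inl p)) (t := fun s p => .inr (.inr (p.2 + s, p.1)))
    (by simp) (fun s i j h => by simpa using h)
    (fun s i j h => by
      simp only [Sum.inr.injEq, Prod.mk.injEq, add_left_inj] at h
      exact Prod.ext h.2 h.1)
    (fun σ : WorkState F ρ n => (σ.1, σ.2.1, fun k i => σ.2.2 k i + ∑ j, m i j k * σ.2.1 i j)) ?_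
  · simpa using this
  · intro σ q
    simp only [ZMod.sum_filter_eq_one, Fintype.sum_prod_type]
    rw [Finset.sum_comm]
    have key := fun i => Fin.sum_sum_add fun j k => m i j k *
      if Sum.inr (.inr (k, i)) = q then workBits b σ (.inr (.inl (i, j))) else 0
    simp only [key]
    rcases q with q | q | ⟨k, i⟩
    · simp [workBits]
    · simp [workBits]
    · simp only [workBits, Sum.elim_inr, Sum.elim_inl, Sum.inr.injEq, Prod.mk.injEq]
      simp [ite_and, Finset.sum_ite_irrel]

/-- Adding the value of a bilinear map on two registers to a third register; the work arrays are
restored. -/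
theorem realizes_bilinear {a a' c : ρ} (ha : a ≠ a') (hac : a ≠ c) (hac' : a' ≠ c)
    (β : F →ₗ[ZMod 2] F →ₗ[ZMod 2] F) :
    Realizes (fun v : ρ → F => workBits (n := n) b (v, 0, 0)) (5 * n) (5 * n ^ 3) fun v =>
      Function.update v c (v c + β (v a) (v a')) := by
  have hT := realizes_tensor b ha
  have hM := realizes_contract (ρ := ρ) b fun i j k => b.repr (β (b i) (b j)) k
  have hS := realizes_rowSum b c
  -- Tensor, contract, row sum, contract, tensor: the repeated stages add the same bits again, since
  -- the register written in between is not one of the factors, and so cancel in characteristic 2.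
  obtain ⟨C, hD, hN, hrev, hC⟩ := hT.comp (hM.comp (hS.comp (hM.comp hT)))
  have h2 : n * n ≤ n ^ 3 := by
    nlinarith [Nat.pos_of_neZero n, Nat.zero_le (n * n), Nat.mul_le_mul_left (n * n)
      (Nat.one_le_iff_ne_zero.2 (NeZero.ne n))]
  refine ⟨C, by omega, ?_, hrev, fun v => ?_⟩
  · refine hN.trans ?_
    have : n * (n * n) = n ^ 3 := by ring
    omega
  · have hβ : ∑ k, (∑ i, ∑ j, b.repr (β (b i) (b j)) k * (b.repr (v a) i * b.repr (v a') j)) • b k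
        = β (v a) (v a') := by
      simp only [← repr_bilinear_apply, b.sum_repr]
    rw [hC]
    congr 1
    simp only [Function.comp_apply, Pi.zero_apply, zero_add, Function.update_of_ne hac,
      Function.update_of_ne hac', hβ, CharTwo.add_self_eq_zero]
    rfl

end Registers

/-! ### Register programs -/

/-- An instruction on registers that hold field elements: adding to a register the image of another
register under a linear map, or of two other registers under a bilinear map. -/
inductive RegOp (F : Type*) [Field F] [Algebra (ZMod 2) F] (ρ : Type) : Type _
  | lin (a c : ρ) (hac : a ≠ c) (L : F →ₗ[ZMod 2] F)
  | bil (a a' c : ρ) (ha : a ≠ a') (hac : a ≠ c) (hac' : a' ≠ c) (β : F →ₗ[ZMod 2] F →ₗ[ZMod 2] F)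

namespace RegOp

variable {F : Type*} [Field F] [Algebra (ZMod 2) F] {ρ : Type} [DecidableEq ρ]

/-- The effect of an instruction. -/
def run : RegOp F ρ → (ρ → F) → ρ → F
  | lin a c _ L, v => Function.update v c (v c + L (v a))
  | bil a a' c _ _ _ β, v => Function.update v c (v c + β (v a) (v a'))

/-- The effect of a program. -/
def runList (l : List (RegOp F ρ)) (v : ρ → F) : ρ → F := l.foldl (fun v o => o.run v) v

/-- The instruction does not involve the registers in `O`. -/
def Avoids (O : Set ρ) : RegOp F ρ → Prop
  | lin a c _ _ => a ∉ O ∧ c ∉ O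
  | bil a a' c _ _ _ _ => a ∉ O ∧ a' ∉ O ∧ c ∉ O

theorem run_lin_apply (a c : ρ) (hac : a ≠ c) (L : F →ₗ[ZMod 2] F) (v : ρ → F) (r : ρ) :
    (lin a c hac L).run v r = if r = c then v c + L (v a) else v r := by
  simp [run, Function.update_apply]

theorem run_bil_apply (a a' c : ρ) (ha : a ≠ a') (hac : a ≠ c) (hac' : a' ≠ c)
    (β : F →ₗ[ZMod 2] F →ₗ[ZMod 2] F) (v : ρ → F) (r : ρ) :
    (bil a a' c ha hac hac' β).run v r = if r = c then v c + β (v a) (v a') else v r := by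
  simp [run, Function.update_apply]

/-- The target is never a source, so the same element is added twice in characteristic 2. -/
theorem run_run (o : RegOp F ρ) (v : ρ → F) : o.run (o.run v) = v := by
  have : CharP F 2 := charP_of_injective_algebraMap' (ZMod 2) 2
  cases o with
  | lin a c hac L => simp [run, Function.update_of_ne hac, add_assoc, CharTwo.add_self_eq_zero]
  | bil a a' c ha hac hac' β =>
    simp [run, Function.update_of_ne hac, Function.update_of_ne hac', add_assoc,
      CharTwo.add_self_eq_zero]

theorem runList_reverse (l : List (RegOp F ρ)) (v : ρ → F) :
    runList l.reverse (runList l v) = v := by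
  induction l generalizing v with
  | nil => rfl
  | cons o l ih =>
    have := ih (o.run v)
    simp only [runList, List.reverse_cons, List.foldl_append, List.foldl_cons, List.foldl_nil]
      at this ⊢
    rw [this, run_run]

open Classical in
-- The instruction neither reads nor writes `O`; hence uncomputation is unaffected by results stored
-- there.
theorem run_piecewise {O : Set ρ} {o : RegOp F ρ} (ho : o.Avoids O) (v w : ρ → F) :
    o.run (O.piecewise w v) = O.piecewise w (o.run v) := by
  cases o with
  | lin a c hac L =>
    obtain ⟨h1, h2⟩ := ho
    simp only [run, Set.piecewise_eq_of_notMem _ _ _ h1, Set.piecewise_eq_of_notMem _ _ _ h2]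
    ext r
    by_cases hr : r = c
    · subst hr
      simp [h2]
    · by_cases hO : r ∈ O <;> simp [hr, hO]
  | bil a a' c ha hac hac' β =>
    obtain ⟨h1, h3, h2⟩ := ho
    simp only [run, Set.piecewise_eq_of_notMem _ _ _ h1, Set.piecewise_eq_of_notMem _ _ _ h2,
      Set.piecewise_eq_of_notMem _ _ _ h3]
    ext r
    by_cases hr : r = c
    · subst hr
      simp [h2]
    · by_cases hO : r ∈ O <;> simp [hr, hO]

open Classical in
theorem runList_piecewise {O : Set ρ} {l : List (RegOp F ρ)} (hl : ∀ o ∈ l, o.Avoids O)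
    (v w : ρ → F) : runList l (O.piecewise w v) = O.piecewise w (runList l v) := by
  induction l generalizing v with
  | nil => rfl
  | cons o l ih =>
    have := ih (fun o' ho' => hl o' (List.mem_cons_of_mem _ ho')) (o.run v)
    simp only [runList, List.foldl_cons] at this ⊢
    rw [run_piecewise (hl o List.mem_cons_self), this]

open Classical in
/-- Computing, writing the result to the registers in `O`, and uncomputing. -/
theorem runList_compute_uncompute {O : Set ρ} {l out : List (RegOp F ρ)}
    (hl : ∀ o ∈ l, o.Avoids O) (v : ρ → F)
    (hout : ∀ u : ρ → F, ∀ r ∉ O, runList out u r = u r) :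
    runList (l ++ out ++ l.reverse) v = O.piecewise (runList out (runList l v)) v := by
  have h1 : runList (l ++ out ++ l.reverse) v =
      runList l.reverse (runList out (runList l v)) := by
    simp [runList]
  have h2 : runList out (runList l v) =
      O.piecewise (runList out (runList l v)) (runList l v) := by
    ext r
    by_cases hr : r ∈ O <;> simp [hr, hout]
  rw [h1, h2, runList_piecewise (fun o ho => hl o (List.mem_reverse.1 ho)), runList_reverse, ← h2]

theorem realizes_run {n : ℕ} [NeZero n] (b : Module.Basis (Fin n) (ZMod 2) F) (o : RegOp F ρ) :
    Realizes (fun v : ρ → F => workBits (n := n) b (v, 0, 0)) (5 * n) (5 * n ^ 3) o.run := by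
  cases o with
  | lin a c hac L =>
    obtain ⟨C, hD, hN, hrev, hC⟩ := realizes_linear b hac L
    have h2 : n * n ≤ n ^ 3 := by
      rw [pow_succ, sq]
      exact Nat.le_mul_of_pos_right _ (Nat.pos_of_neZero n)
    exact ⟨C, by omega, by omega, hrev, fun v => hC (v, 0, 0)⟩
  | bil a a' c ha hac hac' β => exact realizes_bilinear b ha hac hac' β

theorem realizes_runList {n : ℕ} [NeZero n] (b : Module.Basis (Fin n) (ZMod 2) F)
    (l : List (RegOp F ρ)) :
    Realizes (fun v : ρ → F => workBits (n := n) b (v, 0, 0)) (l.length * (5 * n))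
      (l.length * (5 * n ^ 3)) (runList l) := by
  induction l with
  | nil => exact (Realizes.refl _).mono (Nat.zero_le _) (Nat.zero_le _)
  | cons o l ih =>
    refine (ih.comp (realizes_run b o)).mono ?_ ?_ <;> simp [add_mul, add_comm]

end RegOp

/-- A register program on `k` input/output registers and further scratch registers gives a quantum
circuit on the qubits of the former and ancilla qubits. -/
theorem RegOp.exists_circuit {F : Type*} [Field F] [Algebra (ZMod 2) F] {n k m : ℕ} [NeZero n]
    (b : Module.Basis (Fin n) (ZMod 2) F) (l : List (RegOp F (Fin k ⊕ Fin m))) :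
    ∃ C : QCircuit (RegQubits k n (m * n + 2 * n ^ 2)),
      C.depth ≤ l.length * (5 * n) ∧ C.size ≤ l.length * (5 * n ^ 3) ∧
      ∀ v w : Fin k → F, RegOp.runList l (Sum.elim v 0) = Sum.elim w 0 →
        C.toMatrix.mulVec (ket (regBits (m * n + 2 * n ^ 2) b v)) =
          ket (regBits (m * n + 2 * n ^ 2) b w) := by
  obtain ⟨C, hD, hN, hrev, hC⟩ := RegOp.realizes_runList b l
  -- Scratch registers and work arrays become ancillas; any bijection will do, as they all hold 0 at
  -- both ends.
  have e₁ : (Fin m × Fin n) ⊕ ((Fin n × Fin n) ⊕ (Fin n × Fin n)) ≃ Fin (m * n + 2 * n ^ 2) :=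
    Fintype.equivFinOfCardEq (by simp; ring)
  let e : WorkQubits (Fin k ⊕ Fin m) n ≃ RegQubits k n (m * n + 2 * n ^ 2) :=
    ((Equiv.sumProdDistrib _ _ _).sumCongr (.refl _)).trans
      ((Equiv.sumAssoc _ _ _).trans ((Equiv.refl _).sumCongr e₁))
  have he : ∀ v : Fin k → F, regBits (m * n + 2 * n ^ 2) b v ∘ e =
      workBits b (Sum.elim v 0, 0, 0) := by
    intro v
    ext (⟨r | r, i⟩ | q | q) <;> simp [e, regBits, workBits]
  refine ⟨C.map e, (C.depth_map e).trans_le hD, (C.size_map e).trans_le hN, fun v w hvw => ?_⟩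
  rw [(hrev.map e).toMatrix_mulVec_ket]
  congr 1
  have := C.run_map e (regBits (m * n + 2 * n ^ 2) b v)
  simp only [he, hC, hvw] at this
  rw [← he] at this
  exact e.surjective.injective_comp_right this

/-! ### Completeness of the addition law -/

section Complete

variable {F : Type*} [Field F] [Algebra (ZMod 2) F]

theorem trace_sq_zmod_two [Finite F] (z : F) :
    Algebra.trace (ZMod 2) F (z ^ 2) = Algebra.trace (ZMod 2) F z := by
  have := Algebra.trace_eq_of_algEquiv (FiniteField.frobeniusAlgEquivOfAlgebraic (ZMod 2) F) z
  simpa using this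

/-- If it vanished, then x + y ≠ 0 and d₁/(x + y) = t + t². Dividing the curve equation by (x + y)²
would give d₂ = u + u² with u = t + (y + xy)/(x + y), so d₂ would have trace 0 by Frobenius
invariance. -/
theorem binaryEdwards_denominator_ne_zero [Finite F] {d₁ d₂ : F} (hd₁ : d₁ ≠ 0)
    (hd₂ : Algebra.trace (ZMod 2) F d₂ = 1) (t : F) {P : F × F} (hP : P ∈ binaryEdwards d₁ d₂) :
    d₁ + (t + t ^ 2) * (P.1 + P.2) ≠ 0 := by
  have : CharP F 2 := charP_of_injective_algebraMap' (ZMod 2) 2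
  obtain ⟨x, y⟩ := P
  simp only [binaryEdwards, Set.mem_ofPred_eq] at hP ⊢
  intro h
  have h2 : (2 : F) = 0 := CharTwo.two_eq_zero
  have hxy : x + y ≠ 0 := by
    intro h0
    rw [h0] at h
    exact hd₁ (by simpa using h)
  have key : d₂ = (t + (y + x * y) / (x + y)) + (t + (y + x * y) / (x + y)) ^ 2 := by
    field_simp
    linear_combination hP + (x + y) * h + (d₂ * x * y - 3 * x * y * t - 2 * x * y * t ^ 2 - x * y ^ 2
      - x * y ^ 2 * t - x * d₁ - x ^ 2 * y * t - x ^ 2 * t - x ^ 2 * t ^ 2 - y * d₁ - y ^ 2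
      - 2 * y ^ 2 * t - y ^ 2 * t ^ 2) * h2
  rw [key, map_add, trace_sq_zmod_two, CharTwo.add_self_eq_zero] at hd₂
  exact zero_ne_one hd₂

end Complete

/-! ### The program for the addition law -/

section Program

variable {F : Type*} [Field F] [Algebra (ZMod 2) F]

/-- Squaring as a linear map. -/
def sqLinear (F : Type*) [Field F] [Algebra (ZMod 2) F] : F →ₗ[ZMod 2] F where
  toFun x := x ^ 2
  map_add' x y := by
    have : CharP F 2 := charP_of_injective_algebraMap' (ZMod 2) 2
    exact CharTwo.add_sq x y
  map_smul' c x := by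
    have hc : c ^ 2 = c := by revert c; decide
    rw [smul_pow, hc, RingHom.id_apply]

@[simp]
theorem sqLinear_apply (x : F) : sqLinear F x = x ^ 2 := rfl

/-- The bilinear map `(x, y) ↦ d x y`. -/
def scaledMul (d : F) : F →ₗ[ZMod 2] F →ₗ[ZMod 2] F := d • LinearMap.mul (ZMod 2) F

@[simp]
theorem scaledMul_apply (d x y : F) : scaledMul d x y = d * (x * y) := rfl

/-- The registers: `X₁, Y₁, Z₁, X₂, Y₂, Z₂, X₃, Y₃, Z₃` and scratch registers. -/
abbrev EdwardsReg : Type := Fin 9 ⊕ Fin 19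

/-- Scratch computations for the addition law. -/
def edwardsCompute (d₁ d₂ : F) : List (RegOp F EdwardsReg) :=
  [ -- `X₁ + Y₁` and `X₂ + Y₂`
    .lin (.inl 0) (.inr 0) (by decide) .id,
    .lin (.inl 1) (.inr 0) (by decide) .id,
    .lin (.inl 3) (.inr 1) (by decide) .id,
    .lin (.inl 4) (.inr 1) (by decide) .id,
    -- `Z₁²` and `Z₁² Z₂`
    .lin (.inl 2) (.inr 2) (by decide) (sqLinear F),
    .bil (.inr 2) (.inl 5) (.inr 3) (by decide) (by decide) (by decide) (scaledMul 1),
    -- `X₁ Z₁ + X₁²` and `Y₁ Z₁ + Y₁²`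
    .lin (.inl 0) (.inr 4) (by decide) (sqLinear F),
    .bil (.inl 0) (.inl 2) (.inr 4) (by decide) (by decide) (by decide) (scaledMul 1),
    .lin (.inl 1) (.inr 5) (by decide) (sqLinear F),
    .bil (.inl 1) (.inl 2) (.inr 5) (by decide) (by decide) (by decide) (scaledMul 1),
    -- the denominators
    .lin (.inr 3) (.inr 6) (by decide) (scaledMul d₁ 1),
    .bil (.inr 4) (.inr 1) (.inr 6) (by decide) (by decide) (by decide) (scaledMul 1),
    .lin (.inr 3) (.inr 7) (by decide) (scaledMul d₁ 1),
    .bil (.inr 5) (.inr 1) (.inr 7) (by decide) (by decide) (by decide) (scaledMul 1),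
    -- the linear and quadratic parts of the numerators
    .bil (.inr 0) (.inr 1) (.inr 8) (by decide) (by decide) (by decide) (scaledMul d₂),
    .bil (.inl 0) (.inl 5) (.inr 8) (by decide) (by decide) (by decide) (scaledMul d₁),
    .bil (.inl 2) (.inl 3) (.inr 8) (by decide) (by decide) (by decide) (scaledMul d₁),
    .bil (.inr 0) (.inr 1) (.inr 9) (by decide) (by decide) (by decide) (scaledMul d₂),
    .bil (.inl 1) (.inl 5) (.inr 9) (by decide) (by decide) (by decide) (scaledMul d₁),
    .bil (.inl 2) (.inl 4) (.inr 9) (by decide) (by decide) (by decide) (scaledMul d₁),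
    -- `X₂ Y₂`
    .bil (.inl 3) (.inl 4) (.inr 10) (by decide) (by decide) (by decide) (scaledMul 1),
    -- the last factors of the numerators
    .bil (.inl 1) (.inl 3) (.inr 11) (by decide) (by decide) (by decide) (scaledMul 1),
    .bil (.inl 2) (.inl 3) (.inr 11) (by decide) (by decide) (by decide) (scaledMul 1),
    .bil (.inl 1) (.inl 4) (.inr 11) (by decide) (by decide) (by decide) (scaledMul 1),
    .bil (.inl 5) (.inr 11) (.inr 12) (by decide) (by decide) (by decide) (scaledMul 1),
    .bil (.inl 2) (.inr 10) (.inr 12) (by decide) (by decide) (by decide) (scaledMul 1),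
    .bil (.inl 0) (.inl 4) (.inr 13) (by decide) (by decide) (by decide) (scaledMul 1),
    .bil (.inl 2) (.inl 4) (.inr 13) (by decide) (by decide) (by decide) (scaledMul 1),
    .bil (.inl 0) (.inl 3) (.inr 13) (by decide) (by decide) (by decide) (scaledMul 1),
    .bil (.inl 5) (.inr 13) (.inr 14) (by decide) (by decide) (by decide) (scaledMul 1),
    .bil (.inl 2) (.inr 10) (.inr 14) (by decide) (by decide) (by decide) (scaledMul 1),
    -- `Z₁ Z₂`, and its product with the first denominator
    .bil (.inl 2) (.inl 5) (.inr 15) (by decide) (by decide) (by decide) (scaledMul 1),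
    .bil (.inr 6) (.inr 15) (.inr 16) (by decide) (by decide) (by decide) (scaledMul 1),
    -- the numerators
    .bil (.inr 3) (.inr 8) (.inr 17) (by decide) (by decide) (by decide) (scaledMul 1),
    .bil (.inr 4) (.inr 12) (.inr 17) (by decide) (by decide) (by decide) (scaledMul 1),
    .bil (.inr 3) (.inr 9) (.inr 18) (by decide) (by decide) (by decide) (scaledMul 1),
    .bil (.inr 5) (.inr 14) (.inr 18) (by decide) (by decide) (by decide) (scaledMul 1) ]

/-- Writing the sum to the output registers. -/
def edwardsOutput (F : Type*) [Field F] [Algebra (ZMod 2) F] : List (RegOp F EdwardsReg) :=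
  [ .bil (.inr 7) (.inr 17) (.inl 6) (by decide) (by decide) (by decide) (scaledMul 1),
    .bil (.inr 6) (.inr 18) (.inl 7) (by decide) (by decide) (by decide) (scaledMul 1),
    .bil (.inr 7) (.inr 16) (.inl 8) (by decide) (by decide) (by decide) (scaledMul 1) ]

/-- The first denominator, multiplied by `Z₁² Z₂`; the second one is obtained by exchanging the
coordinates. -/
def projDenominator (d₁ X₁ Z₁ X₂ Y₂ Z₂ : F) : F :=
  d₁ * (Z₁ ^ 2 * Z₂) + (X₁ ^ 2 + X₁ * Z₁) * (X₂ + Y₂)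

/-- The first numerator, multiplied by `Z₁³ Z₂²`; the second one is obtained by exchanging the
coordinates. -/
def projNumerator (d₁ d₂ X₁ Y₁ Z₁ X₂ Y₂ Z₂ : F) : F :=
  Z₁ ^ 2 * Z₂ * (d₂ * ((X₁ + Y₁) * (X₂ + Y₂)) + d₁ * (X₁ * Z₂) + d₁ * (Z₁ * X₂)) +
    (X₁ ^ 2 + X₁ * Z₁) * (Z₂ * (Y₁ * X₂ + Z₁ * X₂ + Y₁ * Y₂) + Z₁ * (X₂ * Y₂))

theorem runList_edwards (d₁ d₂ X₁ Y₁ Z₁ X₂ Y₂ Z₂ : F) :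
    RegOp.runList (edwardsCompute d₁ d₂ ++ edwardsOutput F ++ (edwardsCompute d₁ d₂).reverse)
        (Sum.elim ![X₁, Y₁, Z₁, X₂, Y₂, Z₂, 0, 0, 0] 0) =
      Sum.elim ![X₁, Y₁, Z₁, X₂, Y₂, Z₂,
        projDenominator d₁ Y₁ Z₁ X₂ Y₂ Z₂ * projNumerator d₁ d₂ X₁ Y₁ Z₁ X₂ Y₂ Z₂,
        projDenominator d₁ X₁ Z₁ X₂ Y₂ Z₂ * projNumerator d₁ d₂ Y₁ X₁ Z₁ Y₂ X₂ Z₂,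
        projDenominator d₁ Y₁ Z₁ X₂ Y₂ Z₂ *
          (projDenominator d₁ X₁ Z₁ X₂ Y₂ Z₂ * (Z₁ * Z₂))] 0 := by
  classical
  rw [RegOp.runList_compute_uncompute (O := {.inl 6, .inl 7, .inl 8})]
  · ext r
    rcases r with r | r
    · fin_cases r
      all_goals simp only [Set.piecewise, RegOp.runList, edwardsCompute, edwardsOutput,
        List.foldl_cons, List.foldl_nil]
      -- The arrows make the evaluation proceed from the last instruction backwards, one register at
      -- a time.
      all_goals simp [↓RegOp.run_lin_apply, ↓RegOp.run_bil_apply, projDenominator, projNumerator]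
      all_goals ring
    · simp [Set.piecewise]
  · simp [edwardsCompute, RegOp.Avoids]
  · intro u r hr
    simp only [Set.mem_insert_iff, Set.mem_singleton_iff, not_or] at hr
    simp [RegOp.runList, edwardsOutput, RegOp.run, hr]

/-- Numerators carry the factor Z₁³Z₂² and denominators only Z₁²Z₂; the extra Z₁Z₂ in the third
coordinate balances this, and the product of both denominators serves as common denominator. -/
theorem isEdwardsSum_projective [Finite F] {d₁ d₂ : F} (hd₁ : d₁ ≠ 0)
    (hd₂ : Algebra.trace (ZMod 2) F d₂ = 1) {P₁ P₂ : F × F} (hP₂ : P₂ ∈ binaryEdwards d₁ d₂)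
    {X₁ Y₁ Z₁ X₂ Y₂ Z₂ : F} (h₁ : IsProjRep X₁ Y₁ Z₁ P₁) (h₂ : IsProjRep X₂ Y₂ Z₂ P₂) :
    ∃ P₃ : F × F, IsEdwardsSum d₁ d₂ P₁ P₂ P₃ ∧
      IsProjRep
        (projDenominator d₁ Y₁ Z₁ X₂ Y₂ Z₂ * projNumerator d₁ d₂ X₁ Y₁ Z₁ X₂ Y₂ Z₂)
        (projDenominator d₁ X₁ Z₁ X₂ Y₂ Z₂ * projNumerator d₁ d₂ Y₁ X₁ Z₁ Y₂ X₂ Z₂)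
        (projDenominator d₁ Y₁ Z₁ X₂ Y₂ Z₂ *
          (projDenominator d₁ X₁ Z₁ X₂ Y₂ Z₂ * (Z₁ * Z₂))) P₃ := by
  obtain ⟨x₁, y₁⟩ := P₁
  obtain ⟨x₂, y₂⟩ := P₂
  obtain ⟨hZ₁, hX₁, hY₁⟩ := h₁
  obtain ⟨hZ₂, hX₂, hY₂⟩ := h₂
  have hA := binaryEdwards_denominator_ne_zero hd₁ hd₂ x₁ hP₂
  have hB := binaryEdwards_denominator_ne_zero hd₁ hd₂ y₁ hP₂
  simp only at hA hB
  rw [div_eq_iff hZ₁] at hX₁ hY₁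
  rw [div_eq_iff hZ₂] at hX₂ hY₂
  simp only at hX₁ hY₁ hX₂ hY₂
  have hA' : projDenominator d₁ X₁ Z₁ X₂ Y₂ Z₂ =
      Z₁ ^ 2 * Z₂ * (d₁ + (x₁ + x₁ ^ 2) * (x₂ + y₂)) := by
    rw [projDenominator, hX₁, hX₂, hY₂]
    ring
  have hB' : projDenominator d₁ Y₁ Z₁ X₂ Y₂ Z₂ =
      Z₁ ^ 2 * Z₂ * (d₁ + (y₁ + y₁ ^ 2) * (x₂ + y₂)) := by
    rw [projDenominator, hY₁, hX₂, hY₂]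
    ring
  have hNX : projNumerator d₁ d₂ X₁ Y₁ Z₁ X₂ Y₂ Z₂ =
      Z₁ ^ 3 * Z₂ ^ 2 * (d₁ * (x₁ + x₂) + d₂ * (x₁ + y₁) * (x₂ + y₂)
        + (x₁ + x₁ ^ 2) * (x₂ * (y₁ + y₂ + 1) + y₁ * y₂)) := by
    rw [projNumerator, hX₁, hY₁, hX₂, hY₂]
    ring
  have hNY : projNumerator d₁ d₂ Y₁ X₁ Z₁ Y₂ X₂ Z₂ =
      Z₁ ^ 3 * Z₂ ^ 2 * (d₁ * (y₁ + y₂) + d₂ * (x₁ + y₁) * (x₂ + y₂)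
        + (y₁ + y₁ ^ 2) * (y₂ * (x₁ + x₂ + 1) + x₁ * x₂)) := by
    rw [projNumerator, hX₁, hY₁, hX₂, hY₂]
    ring
  refine ⟨(_, _), ⟨hA, hB, rfl, rfl⟩, ?_, ?_, ?_⟩
  · rw [hA', hB']
    simp [hA, hB, hZ₁, hZ₂]
  · rw [hA', hB', hNX, div_eq_div_iff (by simp [hA, hB, hZ₁, hZ₂]) hA]
    ring
  · rw [hA', hB', hNY, div_eq_div_iff (by simp [hA, hB, hZ₁, hZ₂]) hB]
    ring

end Program

theorem mainTheorem5 :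
    ∃ (c : ℕ) (p : Polynomial ℕ),
      ∀ (n : ℕ) (F : Type*) [Field F] [Algebra (ZMod 2) F]
        (b : Module.Basis (Fin n) (ZMod 2) F) (d₁ d₂ : F),
        d₁ ≠ 0 → Algebra.trace (ZMod 2) F d₂ = 1 →
        ∃ (a : ℕ) (C : QCircuit (RegQubits 9 n a)),
          C.depth ≤ c * n ∧ C.size ≤ p.eval n ∧ 9 * n + a ≤ p.eval n ∧
          ∀ P₁ ∈ binaryEdwards d₁ d₂, ∀ P₂ ∈ binaryEdwards d₁ d₂,
          ∀ X₁ Y₁ Z₁ X₂ Y₂ Z₂ : F, IsProjRep X₁ Y₁ Z₁ P₁ → IsProjRep X₂ Y₂ Z₂ P₂ →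
            ∃ (P₃ : F × F) (X₃ Y₃ Z₃ : F),
              IsEdwardsSum d₁ d₂ P₁ P₂ P₃ ∧ IsProjRep X₃ Y₃ Z₃ P₃ ∧
              C.toMatrix.mulVec (ket (regBits a b ![X₁, Y₁, Z₁, X₂, Y₂, Z₂, 0, 0, 0])) =
                ket (regBits a b ![X₁, Y₁, Z₁, X₂, Y₂, Z₂, X₃, Y₃, Z₃]) := by
  -- There are 37 + 3 + 37 = 77 instructions of depth at most 5n, and 77 · 5 = 385. The polynomial
  -- generously covers 385n³ gates and 28n + 2n² qubits.
  refine ⟨385, 1000 * Polynomial.X ^ 3, fun n F _ _ b d₁ d₂ hd₁ hd₂ => ?_⟩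
  have hn : n ≠ 0 := by
    rintro rfl
    exact hd₁ (b.ext_elem fun i => i.elim0)
  have : NeZero n := ⟨hn⟩
  have : Module.Finite (ZMod 2) F := .of_basis b
  have : Finite F := Module.finite_of_finite (ZMod 2)
  obtain ⟨C, hD, hN, hC⟩ := RegOp.exists_circuit b
    (edwardsCompute d₁ d₂ ++ edwardsOutput F ++ (edwardsCompute d₁ d₂).reverse)
  have hlen : (edwardsCompute d₁ d₂ ++ edwardsOutput F ++ (edwardsCompute d₁ d₂).reverse).length
      = 77 := by
    simp [edwardsCompute, edwardsOutput]
  rw [hlen] at hD hN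
  have h1 : n ≤ n ^ 3 := Nat.le_self_pow (by norm_num) n
  have h2 : n ^ 2 ≤ n ^ 3 := Nat.pow_le_pow_right (Nat.pos_of_ne_zero hn) (by norm_num)
  have hp : (1000 * Polynomial.X ^ 3 : Polynomial ℕ).eval n = 1000 * n ^ 3 := by simp
  refine ⟨_, C, by omega, by omega, by omega, ?_⟩
  intro P₁ _ P₂ hP₂ X₁ Y₁ Z₁ X₂ Y₂ Z₂ h₁ h₂
  obtain ⟨P₃, hsum, hrep⟩ := isEdwardsSum_projective hd₁ hd₂ hP₂ h₁ h₂
  exact ⟨P₃, _, _, _, hsum, hrep, hC _ _ (runList_edwards d₁ d₂ X₁ Y₁ Z₁ X₂ Y₂ Z₂)⟩
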